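/- Let $\Omega$ be a finite set and let $G$ be a transitive group of permutations of $\Omega$. Define three properties of $G$. (1) $G$ has the *2-id property* if for every map $t:\Omega\to\Omega$ of rank $2$ (i.e. whose image has exactly two elements) the set $S=\langle G,t\rangle\setminus G$ equals the semigroup generated by the idempotents contained in $S$. Here $\langle G,t\rangle$ is the semigroup of maps $\Omega\to\Omega$ generated by $G$ and $t$. (2) $G$ has the *2-Hc property* if for every $2$-subset $S$ of $\Omega$ and every partition $P$ of $\Omega$ into two parts the *Houghton graph* $H(G,2,P,S)$ is connected. This is the bipartite graph whose vertex set is the disjoint union of the $G$-orbit of $P$ and the $G$-orbit of $S$, with $P'$ joined to $S'$ if and only if $S'$ is a transversal for $P'$ (that is, $S'$ meets each part of $P'$ in exactly one point). (3) $G$ has the *road closure property* if for every orbit $O$ of $G$ on the $2$-subsets of $\Omega$, and every maximal block of imprimitivity $B$ for $G$ acting on $O$ (that is, $B$ is maximal under inclusion among the blocks $C$ with $\emptyset\ne C\subsetneq O$; one-element blocks are allowed), the graph with vertex set $\Omega$ and edge set $O\setminus B$ is connected. Then: (i) $G$ has the 2-id property if and only if it has the road closure property; (ii) $G$ has the 2-Hc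 property if and only if it has the road closure property. -/

import Mathlib

open scoped Pointwise

/-- The permutations belonging to `G`, viewed inside the full transformation monoid on `Ω`. -/
def permMaps {Ω : Type*} (G : Subgroup (Equiv.Perm Ω)) : Set (Function.End Ω) :=
  {f | ∃ g ∈ G, f = (g : Ω → Ω)}

/-- `⟨G, t⟩ \ G`, where `⟨G, t⟩` is the semigroup of transformations generated by `G` and `t`. -/
def singularPart {Ω : Type*} (G : Subgroup (Equiv.Perm Ω)) (t : Function.End Ω) :
    Set (Function.End Ω) :=
  (Subsemigroup.closure (permMaps G ∪ {t}) : Set (Function.End Ω)) \ permMaps G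

/-- `S = ⟨E(S)⟩`: the set `S` is the semigroup generated by the idempotents lying in `S`. -/
def IsIdempotentGenerated {M : Type*} [Mul M] (S : Set M) : Prop :=
  S = (Subsemigroup.closure {e ∈ S | IsIdempotentElem e} : Set M)

/-- The `k`-id property: `⟨G, t⟩ \ G` is idempotent generated for every map `t` of rank `k`. -/
def HasIdProperty {Ω : Type*} (G : Subgroup (Equiv.Perm Ω)) (k : ℕ) : Prop :=
  ∀ t : Function.End Ω, (Set.range (t : Ω → Ω)).ncard = k →
    IsIdempotentGenerated (singularPart G t)

/-- `S` is a transversal for the partition `P` (given as the set of its parts):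
`S` meets every part in exactly one point. -/
def IsTransversal {Ω : Type*} (S : Set Ω) (P : Set (Set Ω)) : Prop :=
  ∀ A ∈ P, ∃! x, x ∈ S ∩ A

/-- The Houghton graph of `G`, `P`, `S`: the bipartite graph on the disjoint union of the
`G`-orbits of `P` and of `S`, with `P'` joined to `S'` when `S'` is a transversal for `P'`. -/
def houghtonGraph {Ω : Type*} (G : Subgroup (Equiv.Perm Ω)) (P : Set (Set Ω)) (S : Set Ω) :
    SimpleGraph (MulAction.orbit G P ⊕ MulAction.orbit G S) where
  Adj
    | Sum.inl P', Sum.inr S' => IsTransversal (S' : Set Ω) (P' : Set (Set Ω))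
    | Sum.inr S', Sum.inl P' => IsTransversal (S' : Set Ω) (P' : Set (Set Ω))
    | _, _ => False
  symm := ⟨by rintro (a | a) (b | b) h <;> exact h⟩
  loopless := ⟨by rintro (a | a) h <;> exact h⟩

/-- The `k`-Hc property: all Houghton graphs of `k`-partitions and `k`-sets are connected. -/
def HasHcProperty {Ω : Type*} (G : Subgroup (Equiv.Perm Ω)) (k : ℕ) : Prop :=
  ∀ (S : Set Ω) (P : Set (Set Ω)), S.ncard = k → Setoid.IsPartition P → P.ncard = k →
    (houghtonGraph G P S).Connected

/-- Maximal blocks of imprimitivity: maximal among the non-empty proper blocks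
(singletons are allowed). -/
def IsMaximalBlock (G : Type*) {X : Type*} [Group G] [MulAction G X] (B : Set X) : Prop :=
  Maximal (fun C : Set X => MulAction.IsBlock G C ∧ C.Nonempty ∧ C ≠ Set.univ) B

/-- The graph with vertex set `Ω` whose edges are the 2-sets belonging to `E`. -/
def graphOfPairs {Ω : Type*} (E : Set (Set Ω)) : SimpleGraph Ω where
  Adj x y := x ≠ y ∧ ({x, y} : Set Ω) ∈ E
  symm := ⟨fun x y h => ⟨h.1.symm, by rw [Set.pair_comm]; exact h.2⟩⟩
  loopless := ⟨fun _ h => h.1 rfl⟩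

/-- The road closure property: for every orbit `O` of `G` on 2-sets (here `O` is the orbit of
`S`) and every maximal block `B` of `G` acting on `O`, the graph `(Ω, O \ B)` is connected. -/
def HasRoadClosureProperty {Ω : Type*} (G : Subgroup (Equiv.Perm Ω)) : Prop :=
  ∀ S : Set Ω, S.ncard = 2 → ∀ B : Set (MulAction.orbit G S), IsMaximalBlock G B →
    (graphOfPairs (MulAction.orbit G S \ (Subtype.val '' B))).Connected

section RoadClosure

variable {Ω : Type*} {G : Subgroup (Equiv.Perm Ω)}

/-- The set `x` is a pair with one element in `A` and the other one outside `A`. -/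
def Crosses (A x : Set Ω) : Prop := ∃ a ∈ A, ∃ b ∉ A, x = {a, b}

lemma smul_pair (g : G) (a b : Ω) : g • ({a, b} : Set Ω) = {g • a, g • b} := by
  rw [← Set.image_smul, Set.image_pair]

lemma Crosses.smul {A x : Set Ω} (h : Crosses A x) (g : G) : Crosses (g • A) (g • x) := by
  obtain ⟨a, ha, b, hb, rfl⟩ := h
  exact ⟨g • a, Set.smul_mem_smul_set ha, g • b, fun h => hb (Set.smul_mem_smul_set_iff.1 h),
    smul_pair g a b⟩

lemma SimpleGraph.Connected.exists_adj_of_cut {V : Type*} {H : SimpleGraph V} (hH : H.Connected)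
    {A : Set V} (hA : A.Nonempty) (hA' : Aᶜ.Nonempty) : ∃ a ∈ A, ∃ b ∉ A, H.Adj a b := by
  obtain ⟨u, hu⟩ := hA
  obtain ⟨v, hv⟩ := hA'
  obtain ⟨p⟩ := hH.preconnected u v
  obtain ⟨d, -, h1, h2⟩ := p.exists_boundary_dart A hu hv
  exact ⟨_, h1, _, h2, d.adj⟩

lemma SimpleGraph.exists_cut_of_not_connected {V : Type*} [Nonempty V] {H : SimpleGraph V}
    (hH : ¬ H.Connected) :
    ∃ A : Set V, A.Nonempty ∧ Aᶜ.Nonempty ∧ ∀ a ∈ A, ∀ b ∉ A, ¬ H.Adj a b := by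
  have h : ¬ H.Preconnected := fun h => hH ⟨h⟩
  simp only [SimpleGraph.Preconnected, not_forall] at h
  obtain ⟨u, v, huv⟩ := h
  exact ⟨{x | H.Reachable u x}, ⟨u, .refl u⟩, ⟨v, huv⟩,
    fun a ha b hb hab => hb (SimpleGraph.Reachable.trans ha hab.reachable)⟩

lemma nonempty_of_ncard_eq_two {S : Set Ω} (hS : S.ncard = 2) : Nonempty Ω :=
  let ⟨a, _⟩ := Set.ncard_eq_two.1 hS
  ⟨a⟩

lemma hasRoadClosureProperty_of_cut
    (h : ∀ S : Set Ω, S.ncard = 2 → ∀ B : Set (MulAction.orbit G S), MulAction.IsBlock G B →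
      B.Nonempty → B ≠ Set.univ → ∀ A : Set Ω, A.Nonempty → Aᶜ.Nonempty →
      ∃ x : MulAction.orbit G S, Crosses A x ∧ x ∉ B) : HasRoadClosureProperty G := by
  intro S hS B hB
  have := nonempty_of_ncard_eq_two hS
  by_contra hcon
  obtain ⟨A, hA, hA', hcut⟩ := SimpleGraph.exists_cut_of_not_connected hcon
  obtain ⟨⟨x, hx⟩, ⟨a, ha, b, hb, rfl⟩, hxB⟩ := h S hS B hB.prop.1 hB.prop.2.1 hB.prop.2.2 A hA hA'
  refine hcut a ha b hb ⟨fun hab => hb (hab ▸ ha), hx, ?_⟩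
  rintro ⟨y, hy, hyx⟩
  exact hxB ((Subtype.ext hyx : y = ⟨_, hx⟩) ▸ hy)

namespace HasRoadClosureProperty

variable [Finite Ω] (hG : HasRoadClosureProperty G) {S : Set Ω} (hS : S.ncard = 2)
include hG hS

lemma exists_crosses_notMem {B : Set (MulAction.orbit G S)} (hB : MulAction.IsBlock G B)
    (hne : B.Nonempty) (hB' : B ≠ Set.univ) {A : Set Ω} (hA : A.Nonempty) (hA' : Aᶜ.Nonempty) :
    ∃ x : MulAction.orbit G S, Crosses A x ∧ x ∉ B := by
  obtain ⟨M, hBM, hM⟩ := Finite.exists_le_maximal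
    (p := fun C : Set (MulAction.orbit G S) => MulAction.IsBlock G C ∧ C.Nonempty ∧ C ≠ Set.univ)
    ⟨hB, hne, hB'⟩
  obtain ⟨a, ha, b, hb, -, hab, hM'⟩ := (hG S hS M hM).exists_adj_of_cut hA hA'
  exact ⟨⟨_, hab⟩, ⟨a, ha, b, hb, rfl⟩, fun h => hM' ⟨_, hBM h, rfl⟩⟩

lemma exists_crosses [MulAction.IsPretransitive G Ω] {A : Set Ω} (hA : A.Nonempty)
    (hA' : Aᶜ.Nonempty) : ∃ x : MulAction.orbit G S, Crosses A x := by
  let S' : MulAction.orbit G S := ⟨S, MulAction.mem_orbit_self S⟩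
  by_cases hu : ({S'} : Set (MulAction.orbit G S)) = Set.univ
  · obtain ⟨a, ha⟩ := hA
    obtain ⟨b, hb⟩ := hA'
    obtain ⟨s, t, hst, hS'⟩ := Set.ncard_eq_two.1 hS
    have key : ∀ c : Ω, c ∈ S := by
      intro c
      obtain ⟨g, rfl⟩ := MulAction.exists_smul_eq G s c
      have h1 : (⟨g • S, MulAction.mem_orbit S g⟩ : MulAction.orbit G S) ∈
        ({S'} : Set (MulAction.orbit G S)) := hu ▸ Set.mem_univ _
      have h2 : g • S = S := congrArg Subtype.val (Set.mem_singleton_iff.1 h1)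
      rw [← h2]
      exact Set.smul_mem_smul_set (by simp [hS'])
    have hab : a ≠ b := fun h => hb (h ▸ ha)
    refine ⟨S', a, ha, b, hb, ?_⟩
    have h1 := key a
    have h2 := key b
    change S = _
    rw [hS'] at h1 h2 ⊢
    rcases h1 with rfl | h1 <;> rcases h2 with rfl | h2
    · exact absurd rfl hab
    · rw [Set.mem_singleton_iff.1 h2]
    · rw [Set.mem_singleton_iff.1 h1, Set.pair_comm]
    · exact absurd (h1.trans h2.symm) hab
  · obtain ⟨x, hx, -⟩ := hG.exists_crosses_notMem hS (MulAction.IsBlock.singleton (a := S'))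
      ⟨S', rfl⟩ hu hA hA'
    exact ⟨x, hx⟩

/-- An invariant equivalence relation on an orbit of pairs relating all the pairs that cross some
cut is universal. -/
lemma rel_of_crosses [MulAction.IsPretransitive G Ω] (r : Setoid (MulAction.orbit G S))
    (hr : ∀ (g : G) x y, r x y → r (g • x) (g • y)) {A : Set Ω} (hA : A.Nonempty)
    (hA' : Aᶜ.Nonempty)
    (hAr : ∀ x y : MulAction.orbit G S, Crosses A x → Crosses A y → r x y)
    (x y : MulAction.orbit G S) : r x y := by
  obtain ⟨z, hz⟩ := hG.exists_crosses hS hA hA'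
  have hblock : MulAction.IsBlock G {w | r z w} := by
    rw [MulAction.isBlock_iff_smul_eq_of_nonempty]
    rintro g ⟨_, ⟨w, hw, rfl⟩, hgw⟩
    have hzg : r z (g • z) := r.trans' hgw (r.symm' (hr g _ _ hw))
    ext v
    rw [Set.mem_smul_set_iff_inv_smul_mem]
    refine ⟨fun hv => r.trans' hzg ?_, fun hv => ?_⟩
    · simpa using hr g _ _ hv
    · simpa using hr g⁻¹ _ _ (r.trans' (r.symm' hzg) hv)
  by_cases hu : {w | r z w} = Set.univ
  · have h : ∀ w, r z w := fun w => (hu ▸ Set.mem_univ w : w ∈ {w | r z w})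
    exact r.trans' (r.symm' (h x)) (h y)
  · obtain ⟨w, hw, hw'⟩ := hG.exists_crosses_notMem hS hblock ⟨z, r.refl' z⟩ hu hA hA'
    exact absurd (hAr z w hz hw) hw'

end HasRoadClosureProperty

end RoadClosure

section Houghton

variable {Ω : Type*} {G : Subgroup (Equiv.Perm Ω)}

lemma isTransversal_pair_iff {A x : Set Ω} : IsTransversal x {A, Aᶜ} ↔ Crosses A x := by
  constructor
  · intro h
    obtain ⟨a, ⟨hax, haA⟩, ha⟩ := h A (by simp)
    obtain ⟨b, ⟨hbx, hbA⟩, hb⟩ := h Aᶜ (by simp)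
    refine ⟨a, haA, b, hbA, ?_⟩
    ext c
    constructor
    · intro hc
      by_cases hcA : c ∈ A
      · exact Or.inl (ha c ⟨hc, hcA⟩)
      · exact Or.inr (hb c ⟨hc, hcA⟩)
    · rintro (rfl | rfl) <;> assumption
  · rintro ⟨a, ha, b, hb, rfl⟩ C (rfl | rfl)
    · refine ⟨a, ⟨by simp, ha⟩, ?_⟩
      rintro c ⟨rfl | rfl, hc⟩
      · rfl
      · exact absurd hc hb
    · refine ⟨b, ⟨by simp, hb⟩, ?_⟩
      rintro c ⟨rfl | rfl, hc⟩
      · exact absurd ha hc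
      · rfl

lemma isTransversal_smul_iff {g : G} {A x : Set Ω} :
    IsTransversal x (g • ({A, Aᶜ} : Set (Set Ω))) ↔ Crosses (g • A) x := by
  rw [← Set.image_smul, Set.image_pair, Set.smul_set_compl, isTransversal_pair_iff]

lemma IsTransversal.smul {x : Set Ω} {P : Set (Set Ω)} (h : IsTransversal x P) (g : G) :
    IsTransversal (g • x) (g • P) := by
  rintro _ ⟨C, hC, rfl⟩
  obtain ⟨a, ⟨hax, haC⟩, ha⟩ := h C hC
  refine ⟨g • a, ⟨Set.smul_mem_smul_set hax, Set.smul_mem_smul_set haC⟩, ?_⟩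
  rintro _ ⟨⟨b, hbx, rfl⟩, hb⟩
  exact congrArg (g • ·) (ha b ⟨hbx, Set.smul_mem_smul_set_iff.1 hb⟩)

lemma exists_eq_pair_compl {P : Set (Set Ω)} (hP : Setoid.IsPartition P) (hcard : P.ncard = 2) :
    ∃ A : Set Ω, A.Nonempty ∧ Aᶜ.Nonempty ∧ P = {A, Aᶜ} := by
  obtain ⟨A, B, hAB, rfl⟩ := Set.ncard_eq_two.1 hcard
  have hB : B = Aᶜ := by
    ext x
    obtain ⟨C, ⟨hC, hxC⟩, huniq⟩ := hP.2 x
    constructor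
    · intro hxB hxA
      exact hAB ((huniq A ⟨by simp, hxA⟩).trans (huniq B ⟨by simp, hxB⟩).symm)
    · intro hxA
      rcases hC with rfl | rfl
      · exact absurd hxC hxA
      · exact hxC
  subst hB
  exact ⟨A, Set.nonempty_iff_ne_empty.2 fun h => hP.1 (by simp [h]),
    Set.nonempty_iff_ne_empty.2 fun h => hP.1 (by simp [h]), rfl⟩

lemma isPartition_pair_compl {A : Set Ω} (hA : A.Nonempty) (hA' : Aᶜ.Nonempty) :
    Setoid.IsPartition ({A, Aᶜ} : Set (Set Ω)) := by
  refine ⟨?_, fun x => ?_⟩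
  · rintro (h | h)
    · exact hA.ne_empty h.symm
    · exact hA'.ne_empty (Set.mem_singleton_iff.1 h).symm
  · by_cases hx : x ∈ A
    · refine ⟨A, ⟨by simp, hx⟩, ?_⟩
      rintro C ⟨rfl | rfl, hC⟩
      · rfl
      · exact absurd hx hC
    · refine ⟨Aᶜ, ⟨by simp, hx⟩, ?_⟩
      rintro C ⟨rfl | rfl, hC⟩
      · exact absurd hC hx
      · rfl

lemma ncard_pair_compl {A : Set Ω} (hA : A.Nonempty) : ({A, Aᶜ} : Set (Set Ω)).ncard = 2 := by
  obtain ⟨a, ha⟩ := hA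
  refine Set.ncard_pair fun h => ?_
  have h' := ha
  rw [h] at h'
  exact h' ha

/-- The action of `g` on the Houghton graph. -/
def houghtonGraphHom (P : Set (Set Ω)) (S : Set Ω) (g : G) :
    houghtonGraph G P S →g houghtonGraph G P S where
  toFun := Sum.map (g • ·) (g • ·)
  map_rel' := by
    rintro (a | a) (b | b) h
    · exact h
    · exact IsTransversal.smul h g
    · exact IsTransversal.smul h g
    · exact h

theorem HasRoadClosureProperty.hasHcProperty [Finite Ω] [MulAction.IsPretransitive G Ω]
    (hG : HasRoadClosureProperty G) : HasHcProperty G 2 := by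
  intro S P hS hP hcard
  obtain ⟨A, hA, hA', rfl⟩ := exists_eq_pair_compl hP hcard
  let H := houghtonGraph G {A, Aᶜ} S
  let r : Setoid (MulAction.orbit G S) :=
    { r := fun x y => H.Reachable (Sum.inr x) (Sum.inr y)
      iseqv := ⟨fun _ => .refl _, .symm, .trans⟩ }
  let P₀ : MulAction.orbit G ({A, Aᶜ} : Set (Set Ω)) := ⟨_, MulAction.mem_orbit_self _⟩
  have hr : ∀ x y, H.Reachable (Sum.inr x) (Sum.inr y) :=
    hG.rel_of_crosses hS r (fun g _ _ h => SimpleGraph.Reachable.map (houghtonGraphHom _ _ g) h)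
      hA hA' fun x y hx hy => by
        have h1 : H.Adj (Sum.inr x) (Sum.inl P₀) := isTransversal_pair_iff.2 hx
        have h2 : H.Adj (Sum.inl P₀) (Sum.inr y) := isTransversal_pair_iff.2 hy
        exact h1.reachable.trans h2.reachable
  let S₀ : MulAction.orbit G S := ⟨S, MulAction.mem_orbit_self S⟩
  have key : ∀ v, H.Reachable v (Sum.inr S₀) := by
    rintro (⟨_, g, rfl⟩ | x)
    · obtain ⟨x, hx⟩ := hG.exists_crosses hS hA hA'
      have h : H.Adj (Sum.inl ⟨_, MulAction.mem_orbit _ g⟩) (Sum.inr (g • x)) :=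
        isTransversal_smul_iff.2 (hx.smul g)
      exact h.reachable.trans (hr _ _)
    · exact hr _ _
  exact (SimpleGraph.connected_iff _).2 ⟨fun u v => (key u).trans (key v).symm, ⟨Sum.inr S₀⟩⟩

theorem HasHcProperty.hasRoadClosureProperty (hG : HasHcProperty G 2) :
    HasRoadClosureProperty G := by
  refine hasRoadClosureProperty_of_cut fun S hS B hB hne hB' A hA hA' => ?_
  by_contra! hcut
  have hconn := hG S _ hS (isPartition_pair_compl hA hA') (ncard_pair_compl hA)
  obtain ⟨x, hx⟩ := hne
  obtain ⟨y, hy⟩ := (Set.ne_univ_iff_exists_notMem B).1 hB'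
  let T : Set (MulAction.orbit G ({A, Aᶜ} : Set (Set Ω)) ⊕ MulAction.orbit G S) :=
    {v | match v with
      | .inl P => ∀ z : MulAction.orbit G S, IsTransversal (z : Set Ω) (P : Set (Set Ω)) → z ∈ B
      | .inr z => z ∈ B}
  obtain ⟨u, hu, v, hv, huv⟩ := hconn.exists_adj_of_cut (A := T) ⟨.inr x, hx⟩ ⟨.inr y, hy⟩
  rcases u with ⟨_, g, rfl⟩ | z <;> rcases v with ⟨_, g', rfl⟩ | w
  · exact huv
  · exact hv (hu w huv)
  · refine hv fun w hw => ?_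
    have hmem : ∀ w : MulAction.orbit G S, Crosses (g' • A) (w : Set Ω) → g'⁻¹ • w ∈ B := by
      intro w hw
      refine hcut _ ?_
      simpa using hw.smul g'⁻¹
    have hz := hmem z (isTransversal_smul_iff.1 huv)
    have hzB : z ∈ B := hu
    have hw' : g'⁻¹ • w ∈ g'⁻¹ • B := by
      rw [hB.smul_eq_of_mem hzB hz]
      exact hmem w (isTransversal_smul_iff.1 hw)
    exact Set.smul_mem_smul_set_iff.1 hw'
  · exact huv

end Houghton

section Parallel

variable {Ω : Type*} (G : Subgroup (Equiv.Perm Ω)) (S A₀ : Set Ω)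

/-- The ordered pair `p` runs from `A` to its complement. -/
def Separates (A : Set Ω) (p : Ω × Ω) : Prop := p.1 ∈ A ∧ p.2 ∉ A

/-- The ordered pairs whose underlying set lies in the orbit of `S`. -/
def arcs : Set (Ω × Ω) := {p : Ω × Ω | ({p.1, p.2} : Set Ω) ∈ MulAction.orbit G S}

/-- The translates of a set and of its complement. -/
def cuts : Set (Set Ω) := {A | ∃ g : G, A = g • A₀ ∨ A = g • A₀ᶜ}

/-- Two arcs are parallel if they are joined by a chain of arcs in which any two neighbours
run across a common cut in the same direction. -/
def Parallel : Ω × Ω → Ω × Ω → Prop :=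
  Relation.EqvGen fun p q =>
    p ∈ arcs G S ∧ q ∈ arcs G S ∧ ∃ A ∈ cuts G A₀, Separates A p ∧ Separates A q

variable {G S A₀}

lemma swap_mem_arcs {p : Ω × Ω} (hp : p ∈ arcs G S) : p.swap ∈ arcs G S := by
  change ({p.2, p.1} : Set Ω) ∈ MulAction.orbit G S
  rw [Set.pair_comm]
  exact hp

lemma smul_mem_arcs {p : Ω × Ω} (hp : p ∈ arcs G S) (g : G) : g • p ∈ arcs G S := by
  change ({g • p.1, g • p.2} : Set Ω) ∈ MulAction.orbit G S
  rw [← smul_pair]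
  exact MulAction.mem_orbit_of_mem_orbit g hp

lemma self_mem_cuts : A₀ ∈ cuts G A₀ := ⟨1, Or.inl (one_smul _ _).symm⟩

lemma compl_mem_cuts {A : Set Ω} (hA : A ∈ cuts G A₀) : Aᶜ ∈ cuts G A₀ := by
  obtain ⟨g, rfl | rfl⟩ := hA
  · exact ⟨g, Or.inr (Set.smul_set_compl).symm⟩
  · exact ⟨g, Or.inl (by rw [Set.smul_set_compl, compl_compl])⟩

lemma smul_mem_cuts {A : Set Ω} (hA : A ∈ cuts G A₀) (g : G) : g • A ∈ cuts G A₀ := by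
  obtain ⟨k, rfl | rfl⟩ := hA
  · exact ⟨g * k, Or.inl (mul_smul _ _ _).symm⟩
  · exact ⟨g * k, Or.inr (mul_smul _ _ _).symm⟩

lemma nonempty_of_mem_cuts {A : Set Ω} (hA₀ : A₀.Nonempty) (hA₀' : A₀ᶜ.Nonempty)
    (hA : A ∈ cuts G A₀) : A.Nonempty := by
  obtain ⟨k, rfl | rfl⟩ := hA
  · exact hA₀.smul_set
  · exact hA₀'.smul_set

lemma Separates.swap {A : Set Ω} {p : Ω × Ω} (h : Separates A p) : Separates Aᶜ p.swap :=
  ⟨h.2, fun h' => h' h.1⟩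

lemma Separates.smul {A : Set Ω} {p : Ω × Ω} (h : Separates A p) (g : G) :
    Separates (g • A) (g • p) :=
  ⟨Set.smul_mem_smul_set h.1, fun h' => h.2 (Set.smul_mem_smul_set_iff.1 h')⟩

namespace Parallel

lemma refl (p : Ω × Ω) : Parallel G S A₀ p p := Relation.EqvGen.refl p

lemma symm {p q : Ω × Ω} (h : Parallel G S A₀ p q) : Parallel G S A₀ q p :=
  Relation.EqvGen.symm _ _ h

lemma trans {p q r : Ω × Ω} (h : Parallel G S A₀ p q) (h' : Parallel G S A₀ q r) :
    Parallel G S A₀ p r :=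
  Relation.EqvGen.trans _ _ _ h h'

lemma of_separates {A : Set Ω} {p q : Ω × Ω} (hp : p ∈ arcs G S) (hq : q ∈ arcs G S)
    (hA : A ∈ cuts G A₀) (hAp : Separates A p) (hAq : Separates A q) : Parallel G S A₀ p q :=
  .rel _ _ ⟨hp, hq, A, hA, hAp, hAq⟩

lemma swap {p q : Ω × Ω} (h : Parallel G S A₀ p q) : Parallel G S A₀ p.swap q.swap := by
  induction h with
  | rel p q h =>
    obtain ⟨hp, hq, A, hA, hAp, hAq⟩ := h
    exact of_separates (swap_mem_arcs hp) (swap_mem_arcs hq) (compl_mem_cuts hA) hAp.swap hAq.swap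
  | refl p => exact refl _
  | symm _ _ _ ih => exact ih.symm
  | trans _ _ _ _ _ ih ih' => exact ih.trans ih'

lemma smul {p q : Ω × Ω} (h : Parallel G S A₀ p q) (g : G) :
    Parallel G S A₀ (g • p) (g • q) := by
  induction h with
  | rel p q h =>
    obtain ⟨hp, hq, A, hA, hAp, hAq⟩ := h
    exact of_separates (smul_mem_arcs hp g) (smul_mem_arcs hq g) (smul_mem_cuts hA g) (hAp.smul g)
      (hAq.smul g)
  | refl p => exact refl _
  | symm _ _ _ ih => exact ih.symm
  | trans _ _ _ _ _ ih ih' => exact ih.trans ih'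

end Parallel

lemma pair_eq_pair_cases {p q : Ω × Ω} (h : ({p.1, p.2} : Set Ω) = {q.1, q.2}) :
    q = p ∨ q = p.swap := by
  rcases Set.pair_eq_pair_iff.1 h with ⟨h1, h2⟩ | ⟨h1, h2⟩
  · exact Or.inl (Prod.ext h1.symm h2.symm)
  · exact Or.inr (Prod.ext h2.symm h1.symm)

variable [Finite Ω] [MulAction.IsPretransitive G Ω] (hG : HasRoadClosureProperty G)
  (hS : S.ncard = 2)
include hG hS

lemma HasRoadClosureProperty.exists_arc_separates {A : Set Ω} (hA : A.Nonempty)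
    (hA' : Aᶜ.Nonempty) : ∃ p ∈ arcs G S, Separates A p := by
  obtain ⟨⟨x, hx⟩, a, ha, b, hb, rfl⟩ := hG.exists_crosses hS hA hA'
  exact ⟨(a, b), hx, ha, hb⟩

variable (hA₀ : A₀.Nonempty) (hA₀' : A₀ᶜ.Nonempty)
include hA₀ hA₀'

lemma HasRoadClosureProperty.parallel_or_parallel_swap {p q : Ω × Ω} (hp : p ∈ arcs G S)
    (hq : q ∈ arcs G S) : Parallel G S A₀ p q ∨ Parallel G S A₀ p q.swap := by
  have hex : ∀ x : MulAction.orbit G S, ∃ p : Ω × Ω, (x : Set Ω) = {p.1, p.2} := by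
    rintro ⟨_, g, rfl⟩
    obtain ⟨a, b, -, rfl⟩ := Set.ncard_eq_two.1 hS
    exact ⟨(g • a, g • b), smul_pair g a b⟩
  let r : Setoid (MulAction.orbit G S) :=
    { r := fun x y => ∀ p q : Ω × Ω, (x : Set Ω) = {p.1, p.2} → (y : Set Ω) = {q.1, q.2} →
        Parallel G S A₀ p q ∨ Parallel G S A₀ p q.swap
      iseqv := by
        refine ⟨fun x p q hp hq => ?_, fun {x y} h p q hp hq => ?_, fun {x y z} h h' p q hp hq => ?_⟩
        · rcases pair_eq_pair_cases (hp.symm.trans hq) with rfl | rfl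
          · exact Or.inl (.refl _)
          · exact Or.inr (.refl _)
        · rcases h q p hq hp with h | h
          · exact Or.inl h.symm
          · exact Or.inr h.swap.symm
        · obtain ⟨w, hw⟩ := hex y
          rcases h p w hp hw with h | h <;> rcases h' w q hw hq with h' | h'
          · exact Or.inl (h.trans h')
          · exact Or.inr (h.trans h')
          · exact Or.inr (h.trans h'.swap)
          · exact Or.inl (h.trans h'.swap) }
  refine hG.rel_of_crosses hS r ?_ hA₀ hA₀' ?_ ⟨_, hp⟩ ⟨_, hq⟩ p q rfl rfl
  · intro g x y h p q hp hq
    have hinv : ∀ (x : MulAction.orbit G S) (p : Ω × Ω), ((g • x : MulAction.orbit G S) : Set Ω) =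
        {p.1, p.2} → (x : Set Ω) = {(g⁻¹ • p).1, (g⁻¹ • p).2} := by
      intro x p hp
      rw [Prod.smul_fst, Prod.smul_snd, ← smul_pair, ← hp, MulAction.orbit.coe_smul,
        inv_smul_smul]
    rcases h _ _ (hinv x p hp) (hinv y q hq) with h | h
    · exact Or.inl (by simpa using h.smul g)
    · exact Or.inr (by simpa using h.smul g)
  · rintro ⟨_, hx⟩ ⟨_, hy⟩ ⟨a, ha, b, hb, rfl⟩ ⟨c, hc, d, hd, rfl⟩ p q hp hq
    have h : Parallel G S A₀ (a, b) (c, d) :=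
      .of_separates hx hy self_mem_cuts ⟨ha, hb⟩ ⟨hc, hd⟩
    rcases pair_eq_pair_cases (p := (a, b)) hp with rfl | rfl <;>
      rcases pair_eq_pair_cases (p := (c, d)) hq with rfl | rfl
    · exact Or.inl h
    · exact Or.inr h
    · exact Or.inr h.swap
    · exact Or.inl h.swap

theorem HasRoadClosureProperty.parallel (hΩ : 2 < Nat.card Ω) {p q : Ω × Ω}
    (hp : p ∈ arcs G S) (hq : q ∈ arcs G S) : Parallel G S A₀ p q := by
  have hor {p q : Ω × Ω} := hG.parallel_or_parallel_swap (p := p) (q := q) hS hA₀ hA₀'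
  suffices h : Parallel G S A₀ p p.swap by
    rcases hor hp hq with h' | h'
    · exact h'
    · exact h.trans h'.swap
  by_contra hcon
  -- the cuts which all the arcs cross in the direction of `p`
  let X : Set (Set Ω) :=
    {A | A ∈ cuts G A₀ ∧ ∀ q ∈ arcs G S, Separates A q → Parallel G S A₀ p q}
  let N : ℕ := X.ncard
  let φ : Ω → ℕ := fun v => {A ∈ X | v ∈ A}.ncard
  have hφN : ∀ v, {A ∈ X | v ∉ A}.ncard + φ v = N := fun v => by
    rw [add_comm]
    exact Set.ncard_inter_add_ncard_sdiff_eq_ncard X {A | v ∈ A}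
  -- along the arcs parallel to `p`, the function `φ` decreases
  have hlt : ∀ q ∈ arcs G S, Parallel G S A₀ p q → φ q.2 < φ q.1 := by
    intro q hq hpq
    refine Set.ncard_lt_ncard ((Set.ssubset_iff_of_subset ?_).2 ?_)
    · rintro A ⟨hA, hA2⟩
      refine ⟨hA, ?_⟩
      by_contra hA1
      exact hcon (hpq.trans (hA.2 _ (swap_mem_arcs hq) ⟨hA2, hA1⟩).swap.symm)
    · obtain ⟨A, hA, hAq⟩ : ∃ A ∈ cuts G A₀, Separates A q := by
        obtain ⟨r, hr, hAr⟩ := hG.exists_arc_separates hS hA₀ hA₀'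
        obtain ⟨g, hg⟩ := MulAction.orbitRel_apply.1
          (MulAction.orbitRel G (Set Ω)|>.trans' hq (MulAction.orbitRel G (Set Ω)|>.symm' hr))
        rcases pair_eq_pair_cases (p := g • r) ((smul_pair g r.1 r.2).symm.trans hg) with rfl | rfl
        · exact ⟨_, smul_mem_cuts self_mem_cuts g, hAr.smul g⟩
        · exact ⟨_, compl_mem_cuts (smul_mem_cuts self_mem_cuts g), (hAr.smul g).swap⟩
      exact ⟨A, ⟨⟨hA, fun s hs hAs => hpq.trans (.of_separates hq hs hA hAq hAs)⟩, hAq.1⟩,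
        fun h => hAq.2 h.2⟩
  have hne : ∀ q ∈ arcs G S, φ q.1 ≠ φ q.2 := by
    intro q hq
    rcases hor hp hq with h | h
    · exact (hlt q hq h).ne'
    · exact (hlt _ (swap_mem_arcs hq) h).ne
  -- every group element preserves or reverses `φ`
  have hsmul : ∀ g : G, (∀ v, φ (g • v) = φ v) ∨ (∀ v, φ (g • v) + φ v = N) := by
    intro g
    rcases hor hp (smul_mem_arcs hp g) with h | h
    · left
      intro v
      have hX : ∀ k : G, Parallel G S A₀ p (k • p) → ∀ A ∈ X, k • A ∈ X := by
        refine fun k hk A hA => ⟨smul_mem_cuts hA.1 k, fun q hq hAq => hk.trans ?_⟩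
        simpa using (hA.2 (k⁻¹ • q) (smul_mem_arcs hq _) (by simpa using hAq.smul k⁻¹)).smul k
      have himg : {A ∈ X | g • v ∈ A} = (g • ·) '' {A ∈ X | v ∈ A} := by
        ext A
        constructor
        · rintro ⟨hA, hv⟩
          exact ⟨g⁻¹ • A, ⟨hX g⁻¹ (by simpa using (h.smul g⁻¹).symm) A hA,
            Set.mem_inv_smul_set_iff.2 hv⟩, smul_inv_smul g A⟩
        · rintro ⟨B, ⟨hB, hv⟩, rfl⟩
          exact ⟨hX g h B hB, Set.smul_mem_smul_set hv⟩
      change Set.ncard _ = _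
      rw [himg, Set.ncard_image_of_injective _ (MulAction.injective g)]
    · right
      intro v
      have hX : ∀ k : G, Parallel G S A₀ p (k • p).swap → ∀ A ∈ X, (k • A)ᶜ ∈ X := by
        refine fun k hk A hA => ⟨compl_mem_cuts (smul_mem_cuts hA.1 k), fun q hq hAq =>
          hk.trans ?_⟩
        have hAq' : Separates (k • A) q.swap := by simpa using hAq.swap
        have := (hA.2 (k⁻¹ • q.swap) (smul_mem_arcs (swap_mem_arcs hq) _)
          (by simpa using hAq'.smul k⁻¹)).smul k
        simpa using this.swap
      have himg : {A ∈ X | g • v ∈ A} = (fun A => (g • A)ᶜ) '' {A ∈ X | v ∉ A} := by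
        ext A
        constructor
        · rintro ⟨hA, hv⟩
          refine ⟨(g⁻¹ • A)ᶜ, ⟨hX g⁻¹ ?_ A hA, fun hv' => hv' (Set.mem_inv_smul_set_iff.2 hv)⟩, ?_⟩
          · simpa using (h.smul g⁻¹).symm.swap
          · simp [Set.smul_set_compl]
        · rintro ⟨B, ⟨hB, hv⟩, rfl⟩
          exact ⟨hX g h B hB, fun hv' => hv (Set.smul_mem_smul_set_iff.1 hv')⟩
      rw [← hφN v]
      congr 1
      change Set.ncard _ = _
      rw [himg, Set.ncard_image_of_injective]
      exact compl_injective.comp (MulAction.injective g)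
  have hinv : ∀ (g : G) u v, φ u = φ v → φ (g • u) = φ (g • v) := by
    intro g u v huv
    rcases hsmul g with h | h
    · rw [h, h, huv]
    · have h1 := h u
      have h2 := h v
      omega
  have htwo : ∀ v, φ v = φ p.1 ∨ φ v + φ p.1 = N := by
    intro v
    obtain ⟨g, rfl⟩ := MulAction.exists_smul_eq G p.1 v
    exact (hsmul g).imp (· p.1) (· p.1)
  obtain ⟨u, v, huv, hφuv⟩ : ∃ u v, u ≠ v ∧ φ u = φ v := by
    classical
    have := Fintype.ofFinite Ω
    obtain ⟨u, v, huv, h⟩ := Fintype.exists_ne_map_eq_of_card_lt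
      (fun v => decide (φ v = φ p.1)) (by rwa [Fintype.card_bool, ← Nat.card_eq_fintype_card])
    refine ⟨u, v, huv, ?_⟩
    have h' : φ u = φ p.1 ↔ φ v = φ p.1 := by simpa using h
    have h1 := htwo u
    have h2 := htwo v
    omega
  obtain ⟨⟨_, g, rfl⟩, a, ha, b, hb, hab⟩ := hG.exists_crosses (Set.ncard_pair huv)
    (A := {x | φ x = φ p.1}) ⟨p.1, rfl⟩ ⟨p.2, (hne p hp).symm⟩
  have hab' : ({g • u, g • v} : Set Ω) = {a, b} := (smul_pair g u v).symm.trans hab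
  have hg := hinv g u v hφuv
  rcases Set.pair_eq_pair_iff.1 hab' with ⟨rfl, rfl⟩ | ⟨rfl, rfl⟩
  · exact hb (hg.symm.trans ha)
  · exact hb (hg.trans ha)

end Parallel

section IdempotentGeneration

variable {Ω : Type*} {G : Subgroup (Equiv.Perm Ω)}

open Classical in
/-- The map with value `p.1` on `A` and value `p.2` outside `A`. -/
noncomputable def twoValued (A : Set Ω) (p : Ω × Ω) : Function.End Ω :=
  fun x => if x ∈ A then p.1 else p.2

lemma twoValued_of_mem {A : Set Ω} {p : Ω × Ω} {x : Ω} (hx : x ∈ A) : twoValued A p x = p.1 :=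
  if_pos hx

lemma twoValued_of_notMem {A : Set Ω} {p : Ω × Ω} {x : Ω} (hx : x ∉ A) : twoValued A p x = p.2 :=
  if_neg hx

lemma twoValued_compl (A : Set Ω) (p : Ω × Ω) : twoValued Aᶜ p = twoValued A p.swap := by
  funext x
  by_cases hx : x ∈ A
  · rw [twoValued_of_mem hx, twoValued_of_notMem (not_not.2 hx), Prod.fst_swap]
  · rw [twoValued_of_mem (A := Aᶜ) hx, twoValued_of_notMem hx, Prod.snd_swap]

lemma twoValued_mul_of_separates {A B : Set Ω} {p q : Ω × Ω} (h : Separates B q) :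
    twoValued B p * twoValued A q = twoValued A p := by
  funext x
  change twoValued B p (twoValued A q x) = _
  by_cases hx : x ∈ A
  · rw [twoValued_of_mem hx, twoValued_of_mem hx, twoValued_of_mem h.1]
  · rw [twoValued_of_notMem hx, twoValued_of_notMem hx, twoValued_of_notMem h.2]

lemma smul_twoValued (g : G) (A : Set Ω) (p : Ω × Ω) (x : Ω) :
    g • twoValued A p x = twoValued A (g • p) x := by
  by_cases hx : x ∈ A
  · rw [twoValued_of_mem hx, twoValued_of_mem hx, Prod.smul_fst]
  · rw [twoValued_of_notMem hx, twoValued_of_notMem hx, Prod.smul_snd]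

lemma twoValued_smul (g : G) (A : Set Ω) (p : Ω × Ω) (x : Ω) :
    twoValued A p (g • x) = twoValued (g⁻¹ • A) p x := by
  by_cases hx : g • x ∈ A
  · rw [twoValued_of_mem hx, twoValued_of_mem (Set.mem_inv_smul_set_iff.2 hx)]
  · rw [twoValued_of_notMem hx, twoValued_of_notMem fun h => hx (Set.mem_inv_smul_set_iff.1 h)]

lemma twoValued_range_subset (A : Set Ω) (p : Ω × Ω) (x : Ω) :
    twoValued A p x ∈ ({p.1, p.2} : Set Ω) := by
  by_cases hx : x ∈ A
  · exact Or.inl (twoValued_of_mem hx)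
  · exact Or.inr (twoValued_of_notMem hx)

lemma ncard_range_of_injective {f : Ω → Ω} (hf : Function.Injective f) :
    (Set.range f).ncard = Nat.card Ω := by
  rw [← Set.image_univ, Set.ncard_image_of_injective _ hf, Set.ncard_univ]

lemma ncard_range_lt_of_not_injective [Finite Ω] {f : Ω → Ω} (hf : ¬ Function.Injective f) :
    (Set.range f).ncard < Nat.card Ω := by
  rw [← Set.ncard_univ]
  refine Set.ncard_lt_ncard (Set.ssubset_univ_iff.2 fun h => hf ?_)
  exact Finite.injective_iff_surjective.2 (Set.range_eq_univ.1 h)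

lemma not_injective_twoValued [Finite Ω] (hΩ : 2 < Nat.card Ω) (A : Set Ω) (p : Ω × Ω) :
    ¬ Function.Injective (twoValued A p : Ω → Ω) := by
  intro h
  have h1 : (Set.range (twoValued A p : Ω → Ω)).ncard ≤ ({p.1, p.2} : Set Ω).ncard :=
    Set.ncard_le_ncard (Set.range_subset_iff.2 (twoValued_range_subset A p)) (Set.toFinite _)
  have h2 := ncard_range_of_injective h
  rw [h2] at h1
  exact absurd (h1.trans (Set.ncard_insert_le _ _)) (by rw [Set.ncard_singleton]; omega)

lemma exists_eq_twoValued {t : Function.End Ω} (ht : (Set.range (t : Ω → Ω)).ncard = 2) :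
    ∃ A : Set Ω, ∃ p : Ω × Ω, A.Nonempty ∧ Aᶜ.Nonempty ∧ p.1 ≠ p.2 ∧ t = twoValued A p := by
  obtain ⟨a, b, hab, h⟩ := Set.ncard_eq_two.1 ht
  obtain ⟨x, hx⟩ : a ∈ Set.range (t : Ω → Ω) := by simp [h]
  obtain ⟨y, hy⟩ : b ∈ Set.range (t : Ω → Ω) := by simp [h]
  refine ⟨{x | t x = a}, (a, b), ⟨x, hx⟩, ⟨y, fun h => hab (h.symm.trans hy)⟩, hab, ?_⟩
  funext z
  by_cases hz : t z = a
  · rw [twoValued_of_mem (A := {x | t x = a}) hz, hz]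
  · rw [twoValued_of_notMem (A := {x | t x = a}) hz]
    have h' : t z ∈ Set.range (t : Ω → Ω) := ⟨z, rfl⟩
    rw [h] at h'
    exact h'.resolve_left hz

lemma ncard_range_twoValued {A : Set Ω} {p : Ω × Ω} (hA : A.Nonempty) (hA' : Aᶜ.Nonempty)
    (hp : p.1 ≠ p.2) : (Set.range (twoValued A p : Ω → Ω)).ncard = 2 := by
  obtain ⟨a, ha⟩ := hA
  obtain ⟨b, hb⟩ := hA'
  have h : Set.range (twoValued A p : Ω → Ω) = {p.1, p.2} := by
    refine (Set.range_subset_iff.2 (twoValued_range_subset A p)).antisymm ?_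
    rintro _ (rfl | rfl)
    · exact ⟨a, twoValued_of_mem ha⟩
    · exact ⟨b, twoValued_of_notMem hb⟩
  rw [h, Set.ncard_pair hp]

/-- The transformation given by an element of `G`. -/
def permMap (g : G) : Function.End Ω := fun x => g • x

lemma permMap_mem_permMaps (g : G) : permMap g ∈ permMaps G :=
  ⟨g, g.2, rfl⟩

lemma injective_of_mem_permMaps {f : Function.End Ω} (hf : f ∈ permMaps G) :
    Function.Injective (f : Ω → Ω) := by
  obtain ⟨g, -, rfl⟩ := hf
  exact g.injective

lemma mul_mem_permMaps {f g : Function.End Ω} (hf : f ∈ permMaps G) (hg : g ∈ permMaps G) :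
    f * g ∈ permMaps G := by
  obtain ⟨f, hf, rfl⟩ := hf
  obtain ⟨g, hg, rfl⟩ := hg
  exact ⟨f * g, mul_mem hf hg, rfl⟩

lemma one_mem_permMaps : (1 : Function.End Ω) ∈ permMaps G := ⟨1, one_mem _, rfl⟩

variable (G) in
/-- The semigroup generated by the idempotents of `⟨G, t⟩ \ G`. -/
def idempotentClosure (t : Function.End Ω) : Subsemigroup (Function.End Ω) :=
  Subsemigroup.closure {e ∈ singularPart G t | IsIdempotentElem e}

lemma permMaps_subset_closure {t f : Function.End Ω} (hf : f ∈ permMaps G) :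
    f ∈ Subsemigroup.closure (permMaps G ∪ {t}) :=
  Subsemigroup.subset_closure (Or.inl hf)

lemma self_mem_closure (t : Function.End Ω) : t ∈ Subsemigroup.closure (permMaps G ∪ {t}) :=
  Subsemigroup.subset_closure (Or.inr rfl)

lemma mem_permMaps_or_not_injective [Finite Ω] {t f : Function.End Ω}
    (ht : ¬ Function.Injective (t : Ω → Ω)) (hf : f ∈ Subsemigroup.closure (permMaps G ∪ {t})) :
    f ∈ permMaps G ∨ ¬ Function.Injective (f : Ω → Ω) := by
  induction hf using Subsemigroup.closure_induction with
  | mem f hf =>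
    rcases hf with hf | rfl
    · exact Or.inl hf
    · exact Or.inr ht
  | mul f g _ _ hf hg =>
    rcases hg with hg | hg
    · rcases hf with hf | hf
      · exact Or.inl (mul_mem_permMaps hf hg)
      · refine Or.inr fun h => hf ?_
        exact (Function.Injective.of_comp_iff' (f : Ω → Ω) (Finite.injective_iff_bijective.1
          (injective_of_mem_permMaps hg))).1 h
    · exact Or.inr fun h => hg (Function.Injective.of_comp (f := (f : Ω → Ω)) h)

lemma idempotentClosure_subset_singularPart [Finite Ω] {t : Function.End Ω}
    (ht : ¬ Function.Injective (t : Ω → Ω)) :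
    (idempotentClosure G t : Set (Function.End Ω)) ⊆ singularPart G t := by
  intro f hf
  induction hf using Subsemigroup.closure_induction with
  | mem f hf => exact hf.1
  | mul f g _ _ hf hg =>
    refine ⟨mul_mem hf.1 hg.1, fun h => ?_⟩
    have hg' : Function.Injective (g : Ω → Ω) :=
      Function.Injective.of_comp (f := (f : Ω → Ω)) (injective_of_mem_permMaps h)
    exact (mem_permMaps_or_not_injective ht hg.1).elim hg.2 (· hg')

lemma singularPart_subset_idempotentClosure {t : Function.End Ω}
    (h : ∀ f ∈ permMaps G, ∀ g ∈ permMaps G, f * t * g ∈ idempotentClosure G t) :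
    singularPart G t ⊆ idempotentClosure G t := by
  rintro s ⟨hs, hs'⟩
  have key : s ∈ permMaps G ∨
      ∀ f ∈ permMaps G, ∀ g ∈ permMaps G, f * s * g ∈ idempotentClosure G t := by
    clear hs'
    induction hs using Subsemigroup.closure_induction with
    | mem s hs =>
      rcases hs with hs | rfl
      · exact Or.inl hs
      · exact Or.inr h
    | mul s s' _ _ hs hs' =>
      rcases hs with hs | hs <;> rcases hs' with hs' | hs'
      · exact Or.inl (mul_mem_permMaps hs hs')
      · refine Or.inr fun f hf g hg => ?_
        simpa [mul_assoc] using hs' (f * s) (mul_mem_permMaps hf hs) g hg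
      · refine Or.inr fun f hf g hg => ?_
        simpa [mul_assoc] using hs f hf (s' * g) (mul_mem_permMaps hs' hg)
      · refine Or.inr fun f hf g hg => ?_
        simpa [mul_assoc] using
          mul_mem (hs f hf 1 one_mem_permMaps) (hs' 1 one_mem_permMaps g hg)
  simpa using key.resolve_left hs' 1 one_mem_permMaps 1 one_mem_permMaps

lemma mem_permMaps_of_injective [Finite Ω] [MulAction.IsPretransitive G Ω] {t : Function.End Ω}
    (hΩ : Nat.card Ω = 2) (ht : Function.Injective (t : Ω → Ω)) : t ∈ permMaps G := by
  rw [← Set.ncard_univ, Set.ncard_eq_two] at hΩ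
  obtain ⟨a, b, hab, hU⟩ := hΩ
  obtain ⟨g, hg⟩ := MulAction.exists_smul_eq G a (t a)
  have hU' : ∀ x, x = a ∨ x = b := fun x => (hU ▸ Set.mem_univ x : x ∈ ({a, b} : Set Ω))
  have h1 : t b ≠ t a := fun h => hab (ht h).symm
  have h2 : g • b ≠ t a := fun h => hab (MulAction.injective g (hg.trans h.symm))
  refine ⟨g, g.2, funext fun x => ?_⟩
  rcases hU' x with rfl | rfl
  · exact hg.symm
  · change t x = g • x
    rcases hU' (t x) with h | h <;> rcases hU' (t a) with h' | h' <;>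
      rcases hU' (g • x) with h'' | h'' <;> grind

lemma twoValued_mem_closure {A₀ A : Set Ω} {p₀ p : Ω × Ω} (hA : A ∈ cuts G A₀)
    (hp : p ∈ arcs G {p₀.1, p₀.2}) :
    twoValued A p ∈ Subsemigroup.closure (permMaps G ∪ {twoValued A₀ p₀}) ∨
      twoValued A p.swap ∈ Subsemigroup.closure (permMaps G ∪ {twoValued A₀ p₀}) := by
  have key : ∀ g k : G, twoValued (k • A₀) (g • p₀) ∈
      Subsemigroup.closure (permMaps G ∪ {twoValued A₀ p₀}) := by
    intro g k
    have h : twoValued (k • A₀) (g • p₀) = permMap g * twoValued A₀ p₀ *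
        permMap k⁻¹ := by
      funext x
      change _ = g • twoValued A₀ p₀ (k⁻¹ • x)
      rw [smul_twoValued, twoValued_smul, inv_inv]
    rw [h]
    exact mul_mem (mul_mem (permMaps_subset_closure (permMap_mem_permMaps g)) (self_mem_closure _))
      (permMaps_subset_closure (permMap_mem_permMaps k⁻¹))
  obtain ⟨g, hg⟩ := hp
  obtain ⟨k, rfl | rfl⟩ := hA <;>
    rcases pair_eq_pair_cases (p := g • p₀) ((smul_pair g p₀.1 p₀.2).symm.trans hg) with rfl | rfl
  · exact Or.inl (key g k)
  · exact Or.inr (key g k)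
  · right
    rw [Set.smul_set_compl, twoValued_compl, Prod.swap_swap]
    exact key g k
  · left
    rw [Set.smul_set_compl, twoValued_compl, Prod.swap_swap]
    exact key g k

lemma twoValued_mem_idempotentClosure [Finite Ω] (hΩ : 2 < Nat.card Ω) {A₀ A : Set Ω}
    {p₀ p : Ω × Ω} (hA : A ∈ cuts G A₀) (hp : p ∈ arcs G {p₀.1, p₀.2}) (hAp : Separates A p) :
    twoValued A p ∈ idempotentClosure G (twoValued A₀ p₀) := by
  have hidem : twoValued A p * twoValued A p = twoValued A p := twoValued_mul_of_separates hAp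
  refine Subsemigroup.subset_closure ⟨⟨?_, fun h => not_injective_twoValued hΩ A p
    (injective_of_mem_permMaps h)⟩, hidem⟩
  rcases twoValued_mem_closure hA hp with h | h
  · exact h
  · have h2 : twoValued A p.swap * twoValued A p.swap = twoValued A p := by
      funext x
      change twoValued A p.swap (twoValued A p.swap x) = _
      by_cases hx : x ∈ A
      · rw [twoValued_of_mem hx, twoValued_of_mem hx]
        exact twoValued_of_notMem hAp.2
      · rw [twoValued_of_notMem hx, twoValued_of_notMem hx]
        exact twoValued_of_mem hAp.1
    exact h2 ▸ mul_mem h h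

theorem HasRoadClosureProperty.hasIdProperty [Finite Ω] [MulAction.IsPretransitive G Ω]
    (hG : HasRoadClosureProperty G) : HasIdProperty G 2 := by
  intro t ht
  by_cases hinj : Function.Injective (t : Ω → Ω)
  · have hΩ : Nat.card Ω = 2 := (ncard_range_of_injective hinj).symm.trans ht
    have htG : t ∈ permMaps G := mem_permMaps_of_injective hΩ hinj
    have hempty : singularPart G t = ∅ := by
      refine Set.eq_empty_of_forall_notMem fun f hf => hf.2 ?_
      have hf' := hf.1
      clear hf
      rw [Set.union_eq_self_of_subset_right (Set.singleton_subset_iff.2 htG)] at hf'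
      induction hf' using Subsemigroup.closure_induction with
      | mem f hf => exact hf
      | mul f g _ _ hf hg => exact mul_mem_permMaps hf hg
    simp [IsIdempotentGenerated, hempty]
  obtain ⟨A₀, p₀, hA₀, hA₀', hp₀, rfl⟩ := exists_eq_twoValued ht
  have hS : ({p₀.1, p₀.2} : Set Ω).ncard = 2 := Set.ncard_pair hp₀
  have hΩ : 2 < Nat.card Ω := ht ▸ ncard_range_lt_of_not_injective hinj
  refine Set.Subset.antisymm (singularPart_subset_idempotentClosure ?_)
    (idempotentClosure_subset_singularPart hinj)
  have key : ∀ A ∈ cuts G A₀, ∀ p ∈ arcs G {p₀.1, p₀.2},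
      twoValued A p ∈ idempotentClosure G (twoValued A₀ p₀) := by
    intro A hA p hp
    obtain ⟨q, hq, hAq⟩ := hG.exists_arc_separates hS (nonempty_of_mem_cuts hA₀ hA₀' hA)
      (nonempty_of_mem_cuts hA₀ hA₀' (compl_mem_cuts hA))
    have hqA := twoValued_mem_idempotentClosure hΩ hA hq hAq
    have hpar := hG.parallel hS hA₀ hA₀' hΩ hq hp
    clear hAq
    have hiff : twoValued A q ∈ idempotentClosure G (twoValued A₀ p₀) ↔
        twoValued A p ∈ idempotentClosure G (twoValued A₀ p₀) := by
      clear hp hq hqA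
      induction hpar with
      | rel q p h =>
        obtain ⟨hq, hp, B, hB, hBq, hBp⟩ := h
        constructor
        · intro h
          rw [← twoValued_mul_of_separates (A := A) hBq]
          exact mul_mem (twoValued_mem_idempotentClosure hΩ hB hp hBp) h
        · intro h
          rw [← twoValued_mul_of_separates (A := A) hBp]
          exact mul_mem (twoValued_mem_idempotentClosure hΩ hB hq hBq) h
      | refl => exact Iff.rfl
      | symm _ _ _ ih => exact ih.symm
      | trans _ _ _ _ _ ih ih' => exact ih.trans ih'
    exact hiff.1 hqA
  rintro _ ⟨g, hg, rfl⟩ _ ⟨k, hk, rfl⟩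
  have h : permMap (⟨g, hg⟩ : G) * twoValued A₀ p₀ * permMap (⟨k, hk⟩ : G) =
      twoValued ((⟨k, hk⟩ : G)⁻¹ • A₀) ((⟨g, hg⟩ : G) • p₀) := by
    funext x
    rw [← smul_twoValued, ← twoValued_smul]
    rfl
  change permMap (⟨g, hg⟩ : G) * twoValued A₀ p₀ * permMap (⟨k, hk⟩ : G) ∈ _
  rw [h]
  exact key _ (smul_mem_cuts self_mem_cuts _) _ (smul_mem_arcs (MulAction.mem_orbit_self _) _)

end IdempotentGeneration

section IdempotentGeneration

variable {Ω : Type*} {G : Subgroup (Equiv.Perm Ω)}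

/-- The elements of `⟨G, t⟩ \ G`, for a two-valued map `t`, have image in a translate of the image
of `t` and factor through a translate of the kernel of `t`. -/
lemma image_and_kernel_of_mem_closure {A : Set Ω} {p : Ω × Ω} {f : Function.End Ω}
    (hf : f ∈ Subsemigroup.closure (permMaps G ∪ {twoValued A p})) :
    f ∈ permMaps G ∨ (∃ g : G, ∀ x, f x ∈ g • ({p.1, p.2} : Set Ω)) ∧
      ∃ h : G, ∀ x y, (x ∈ h • A ↔ y ∈ h • A) → f x = f y := by
  induction hf using Subsemigroup.closure_induction with
  | mem f hf =>
    rcases hf with hf | rfl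
    · exact Or.inl hf
    · refine Or.inr ⟨⟨1, fun x => ?_⟩, 1, fun x y hxy => ?_⟩
      · rw [one_smul]
        exact twoValued_range_subset A p x
      · rw [one_smul] at hxy
        by_cases hx : x ∈ A
        · rw [twoValued_of_mem hx, twoValued_of_mem (hxy.1 hx)]
        · rw [twoValued_of_notMem hx, twoValued_of_notMem fun h => hx (hxy.2 h)]
  | mul f f' _ _ hf hf' =>
    rcases hf' with hf' | ⟨⟨g', hg'⟩, h', hh'⟩
    · rcases hf with hf | ⟨⟨g, hg⟩, h, hh⟩
      · exact Or.inl (mul_mem_permMaps hf hf')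
      · obtain ⟨k, hk, rfl⟩ := hf'
        refine Or.inr ⟨⟨g, fun x => hg _⟩, (⟨k, hk⟩ : G)⁻¹ * h, fun x y hxy => hh _ _ ?_⟩
        rwa [mul_smul, Set.mem_inv_smul_set_iff, Set.mem_inv_smul_set_iff] at hxy
    · refine Or.inr ⟨?_, h', fun x y hxy => congrArg f (hh' x y hxy)⟩
      rcases hf with ⟨k, hk, rfl⟩ | ⟨⟨g, hg⟩, -⟩
      · refine ⟨(⟨k, hk⟩ : G) * g', fun x => ?_⟩
        rw [mul_smul]
        exact Set.smul_mem_smul_set (a := (⟨k, hk⟩ : G)) (hg' x)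
      · exact ⟨g, fun x => hg _⟩

lemma crosses_of_ne {A : Set Ω} {u v : Ω} {f : Ω → Ω}
    (hf : ∀ x y, (x ∈ A ↔ y ∈ A) → f x = f y) (huv : f u ≠ f v) : Crosses A {u, v} := by
  have h : ¬ (u ∈ A ↔ v ∈ A) := fun h => huv (hf u v h)
  by_cases hu : u ∈ A
  · exact ⟨u, hu, v, fun hv => h (by tauto), rfl⟩
  · exact ⟨v, by tauto, u, hu, Set.pair_comm u v⟩

lemma pair_eq_of_mem {a b u v : Ω} (hu : u ∈ ({a, b} : Set Ω)) (hv : v ∈ ({a, b} : Set Ω))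
    (huv : u ≠ v) : ({u, v} : Set Ω) = {a, b} := by
  rcases hu with rfl | rfl <;> rcases hv with rfl | rfl
  · exact absurd rfl huv
  · rfl
  · exact Set.pair_comm _ _
  · exact absurd rfl huv

theorem HasIdProperty.hasRoadClosureProperty [Finite Ω] (hG : HasIdProperty G 2) :
    HasRoadClosureProperty G := by
  refine hasRoadClosureProperty_of_cut fun S hS B hB hne hB' A hA hA' => ?_
  by_contra! hcut
  obtain ⟨a, b, hab, rfl⟩ := Set.ncard_eq_two.1 hS
  obtain ⟨y, hy⟩ := (Set.ne_univ_iff_exists_notMem B).1 hB'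
  obtain ⟨x, hx⟩ := hne
  have hcard : ∀ z : MulAction.orbit G ({a, b} : Set Ω), (z : Set Ω).ncard = 2 := by
    rintro ⟨_, g, rfl⟩
    exact (Set.ncard_image_of_injective _ (MulAction.injective g)).trans hS
  have hΩ : 2 < Nat.card Ω := by
    by_contra! hle
    have huniv : ∀ z : MulAction.orbit G ({a, b} : Set Ω), (z : Set Ω) = Set.univ := fun z =>
      Set.eq_of_subset_of_ncard_le (Set.subset_univ _) (by rw [Set.ncard_univ, hcard z]; exact hle)
    exact hy (Subtype.ext ((huniv x).trans (huniv y).symm) ▸ hx)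
  set t : Function.End Ω := twoValued A (a, b) with ht
  have ht' : ¬ Function.Injective (t : Ω → Ω) := not_injective_twoValued hΩ _ _
  have hid : singularPart G t = idempotentClosure G t :=
    hG t (ncard_range_twoValued hA hA' hab)
  have hcutB : ∀ (h : G) (z : MulAction.orbit G ({a, b} : Set Ω)), Crosses (h • A) (z : Set Ω) →
      z ∈ h • B := by
    intro h z hz
    rw [Set.mem_smul_set_iff_inv_smul_mem]
    refine hcut _ ?_
    simpa using hz.smul h⁻¹
  -- idempotents map an arc into the translate of `B` containing it
  have hidem : ∀ e ∈ singularPart G t, IsIdempotentElem e → ∀ u v, e u ≠ e v →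
      ∃ h : G, Crosses (h • A) {u, v} ∧ ∃ z : MulAction.orbit G ({a, b} : Set Ω),
        (z : Set Ω) = {e u, e v} ∧ Crosses (h • A) (z : Set Ω) := by
    intro e he hee u v huv
    obtain ⟨⟨g, hg⟩, h, hh⟩ := (image_and_kernel_of_mem_closure he.1).resolve_left he.2
    refine ⟨h, crosses_of_ne hh huv, ⟨_, MulAction.mem_orbit _ g⟩, ?_⟩
    have himg : g • ({a, b} : Set Ω) = {e u, e v} := by
      have h1 := hg u
      have h2 := hg v
      rw [smul_pair] at h1 h2 ⊢
      exact (pair_eq_of_mem h1 h2 huv).symm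
    have hee' : ∀ w, e (e w) = e w := fun w => congrFun hee w
    refine ⟨himg, ?_⟩
    change Crosses (h • A) (g • ({a, b} : Set Ω))
    rw [himg]
    refine crosses_of_ne hh ?_
    rwa [hee', hee']
  have hblock : ∀ f ∈ idempotentClosure G t, ∀ x : MulAction.orbit G ({a, b} : Set Ω), ∀ u v,
      (x : Set Ω) = {u, v} → f u ≠ f v → ∃ z : MulAction.orbit G ({a, b} : Set Ω),
        (z : Set Ω) = {f u, f v} ∧ ∀ k : G, x ∈ k • B → z ∈ k • B := by
    intro f hf
    induction hf using Subsemigroup.closure_induction with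
    | mem e he =>
      intro x u v hx huv
      obtain ⟨h, hc, z, hz, hzc⟩ := hidem e he.1 he.2 u v huv
      refine ⟨z, hz, fun k hk => ?_⟩
      have hxh := hcutB h x (hx ▸ hc)
      have hkh : k • B = h • B := by
        by_contra hne
        exact Set.disjoint_left.1 (hB hne) hk hxh
      exact hkh ▸ hcutB h z hzc
    | mul f f' _ _ hf hf' =>
      intro x u v hx huv
      obtain ⟨z, hz, hzB⟩ := hf' x u v hx fun h => huv (congrArg f h)
      obtain ⟨w, hw, hwB⟩ := hf z _ _ hz huv
      exact ⟨w, hw, fun k hk => hwB k (hzB k hk)⟩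
  have hsing : ∀ g : G, permMap g * t ∈ singularPart G t := fun g =>
    ⟨mul_mem (permMaps_subset_closure (permMap_mem_permMaps g)) (self_mem_closure t), fun h =>
      ht' (Function.Injective.of_comp (f := (permMap g : Ω → Ω)) (injective_of_mem_permMaps h))⟩
  obtain ⟨e, he, hee, u, v, huv⟩ : ∃ e ∈ singularPart G t, IsIdempotentElem e ∧
      ∃ u v, e u ≠ e v := by
    by_contra! hconst
    have hall : ∀ f ∈ idempotentClosure G t, ∀ u v, f u = f v := by
      intro f hf
      induction hf using Subsemigroup.closure_induction with
      | mem e he => exact hconst e he.1 he.2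
      | mul f f' _ _ hf _ => exact fun u v => hf _ _
    obtain ⟨c, hc⟩ := hA
    obtain ⟨d, hd⟩ := hA'
    have h := hall _ (hid ▸ hsing 1 : permMap (1 : G) * t ∈ (idempotentClosure G t : Set _)) c d
    have h' : (1 : G) • t c = (1 : G) • t d := h
    rw [one_smul, one_smul, ht, twoValued_of_mem hc, twoValued_of_notMem hd] at h'
    exact hab h'
  obtain ⟨h, -, z, -, hz⟩ := hidem e he hee u v huv
  have hz' : Crosses A ((h⁻¹ • z : MulAction.orbit G ({a, b} : Set Ω)) : Set Ω) := by
    simpa using hz.smul h⁻¹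
  have hzB := hcut _ hz'
  obtain ⟨c, hc, d, hd, hcd⟩ := hz'
  obtain ⟨g, hg⟩ := y.2
  have hfc : (permMap g * t) c = g • a := congrArg (g • ·) (twoValued_of_mem hc)
  have hfd : (permMap g * t) d = g • b := congrArg (g • ·) (twoValued_of_notMem hd)
  obtain ⟨w, hw, hwB⟩ := hblock _
    (hid ▸ hsing g : permMap g * t ∈ (idempotentClosure G t : Set _)) _ c d hcd
    (by rw [hfc, hfd]; exact fun h => hab (MulAction.injective g h))
  have hwy : w = y := by
    refine Subtype.ext ?_
    rw [hw, hfc, hfd, ← hg, ← smul_pair]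
  obtain ⟨w', hw', hww'⟩ := hwB 1 ⟨_, hzB, one_smul G _⟩
  exact hy ((((one_smul G w').symm.trans hww').trans hwy) ▸ hw')

end IdempotentGeneration

theorem mainTheorem4 {Ω : Type*} [Finite Ω] (G : Subgroup (Equiv.Perm Ω))
    [MulAction.IsPretransitive G Ω] :
    (HasIdProperty G 2 ↔ HasRoadClosureProperty G) ∧
      (HasHcProperty G 2 ↔ HasRoadClosureProperty G) :=
  ⟨⟨HasIdProperty.hasRoadClosureProperty, HasRoadClosureProperty.hasIdProperty⟩,
    ⟨HasHcProperty.hasRoadClosureProperty, HasRoadClosureProperty.hasHcProperty⟩⟩
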